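/- Let $G$ be a finite simple graph with vertex set $V$, and let $n$, $m$, $c$ be its numbers of vertices, edges and connected components. Fix an arbitrary orientation of each edge, let $E\subseteq V\times V$ be the resulting set of oriented edges, and let $B:\mathbb{R}^E\to\mathbb{R}^V$ be the incidence matrix, with entries $b_{i,(j,k)}=\delta_{ik}-\delta_{ij}$. Put $H_1(G)=\ker B\subseteq\mathbb{R}^E$ and let $H_1(G)^\perp$ be its orthogonal complement for the standard inner product. Let $f:\mathbb{R}\to\mathbb{R}$ be a non-constant, odd, real-analytic function, let $\mathbf{f}:\mathbb{R}^E\to\mathbb{R}^E$ apply $f$ to each coordinate, and define the set of equilibria (up to translational symmetry) of the system $\dot x_i=\sum_{j\in N(i)} f(x_j-x_i)$, $i\in V$, where $N(i)$ is the set of neighbours of $i$, by $$\mathcal{E}(G,f)=\mathbf{f}^{-1}(H_1(G))\cap H_1(G)^\perp\subseteq\mathbb{R}^E .$$ Let $\dim\mathcal{E}(G,f)$ be the maximum dimension of a nonempty smooth (embedded $C^\infty$) submanifold of $\mathbb{R}^E$ contained in $\mathcal{E}(G,f)$. Then this maximum exists and $$\dim\mathcal{E}(G,f)\le n-c,\qquad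 \dim\mathcal{E}(G,f)\le\left\lfloor\frac{m}{2}\right\rfloor,\qquad \dim\mathcal{E}(G,f)\le m-n+c .$$ -/

import Mathlib

open scoped ContDiff

namespace GraphDyn

/-- The class of coupling functions: non-constant, odd, real-analytic functions `ℝ → ℝ`. -/
structure IsCoupling (f : ℝ → ℝ) : Prop where
  analytic : AnalyticOnNhd ℝ f Set.univ
  odd : ∀ x, f (-x) = -f x
  not_const : ¬ ∃ a, ∀ x, f x = a

/-- A choice of one of the two orientations `(tail e, head e)` of each edge `e` of `G`. -/
structure EdgeOrientation {V : Type*} (G : SimpleGraph V) where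
  tail : G.edgeSet → V
  head : G.edgeSet → V
  mk_eq : ∀ e, s(tail e, head e) = (e : Sym2 V)

instance {V : Type*} (G : SimpleGraph V) : Nonempty (EdgeOrientation G) :=
  ⟨{ tail := fun e => (Quot.out (e : Sym2 V)).1
     head := fun e => (Quot.out (e : Sym2 V)).2
     mk_eq := fun e => Quot.out_eq (e : Sym2 V) }⟩

section Graph

variable {V : Type*} [Fintype V] [DecidableEq V] {G : SimpleGraph V} [DecidableRel G.Adj]

/-- The incidence matrix, with entry `δ_{ik} - δ_{ij}` at the vertex `i` and the oriented
edge `(j, k)`. -/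
def incidence (o : EdgeOrientation G) : Matrix V G.edgeSet ℝ :=
  Matrix.of fun i e => (if i = o.head e then 1 else 0) - (if i = o.tail e then 1 else 0)

/-- The first homology group `H₁ = ker B`, as a subspace of the Euclidean edge space. -/
noncomputable def homologyOne (o : EdgeOrientation G) :
    Submodule ℝ (EuclideanSpace ℝ G.edgeSet) :=
  LinearMap.ker (Matrix.toEuclideanLin (incidence o))

/-- The coordinatewise application of `f` on the edge space. -/
noncomputable def edgeMap (G : SimpleGraph V) (f : ℝ → ℝ)
    (y : EuclideanSpace ℝ G.edgeSet) : EuclideanSpace ℝ G.edgeSet :=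
  WithLp.toLp 2 fun e => f (y e)

/-- The set of equilibria up to translational symmetry, `𝐟⁻¹(H₁) ∩ H₁ᗮ`. -/
def equilibria (o : EdgeOrientation G) (f : ℝ → ℝ) : Set (EuclideanSpace ℝ G.edgeSet) :=
  edgeMap G f ⁻¹' (homologyOne o : Set (EuclideanSpace ℝ G.edgeSet)) ∩
    ((homologyOne o)ᗮ : Set (EuclideanSpace ℝ G.edgeSet))

end Graph

section Dimension

variable {F : Type*} [NormedAddCommGroup F] [NormedSpace ℝ F]

/-- `M` is a smooth (embedded) submanifold of dimension `d` of the vector space `F`: near each of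
its points it has a parametrization by an open subset of `ℝᵈ` that is smooth, an immersion, and a
homeomorphism onto its image. -/
def IsSmoothSubmanifold (d : ℕ) (M : Set F) : Prop :=
  ∀ p ∈ M, ∃ (U : Set F) (W : Set (EuclideanSpace ℝ (Fin d))) (φ : EuclideanSpace ℝ (Fin d) → F),
    IsOpen U ∧ p ∈ U ∧ IsOpen W ∧
      ContDiffOn ℝ ∞ φ W ∧ (∀ w ∈ W, Function.Injective (fderiv ℝ φ w)) ∧
      Topology.IsEmbedding (fun w : W => φ w) ∧ φ '' W = M ∩ U

/-- The dimension of a set `X`: the maximum dimension of a nonempty smooth manifold contained in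
`X` (`⊥` if `X` is empty). -/
noncomputable def manifoldDim (X : Set F) : WithBot ℕ∞ :=
  ⨆ (d : ℕ) (_ : ∃ M : Set F, M.Nonempty ∧ M ⊆ X ∧ IsSmoothSubmanifold d M), (d : WithBot ℕ∞)

end Dimension

end GraphDyn

/-!
Let `φ` be a smooth immersion of an open set `W ⊆ ℝᵈ` into the equilibrium set. Since `φ` takes
values in `H₁ᗮ`, so do its derivatives, whence `d ≤ dim H₁ᗮ`. Since `𝐟 ∘ φ` takes values in `H₁`,
the derivative `diag (f' (φₑ w)) ∘ Dφ(w)` maps into `H₁`; once it is injective for some `w`, also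
`d ≤ dim H₁`.

Injectivity could fail only because some `f' (φₑ w)` vanishes. The zeros of the analytic function
`f' ≢ 0` are isolated, so if `f' ∘ φₑ` vanishes on an open set, then `φₑ` is locally constant
there. Shrinking `W` once for each edge yields a point `w` at which, for every edge `e`, either
`f' (φₑ w) ≠ 0` or `Dφₑ(w) = 0` (`exists_deriv_ne_zero_or_fderiv_eq_zero`). At such a point
multiplication by the factors `f' (φₑ w)` kills no nonzero vector in the range of `Dφ(w)`.

The kernel of the transposed incidence matrix is that of the graph Laplacian, so it has dimension
`c`. Hence `dim H₁ᗮ = n - c` and `dim H₁ = m - n + c`; these add up to `m`, which gives the bound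
`m / 2`. The origin is an equilibrium because `f` is odd, so the dimension is not `⊥`.
-/

namespace GraphDyn

/-! ### Dimension of the homology group -/

section Homology

variable {V : Type*} [Fintype V] [DecidableEq V] {G : SimpleGraph V}

lemma incidence_transpose_mulVec (o : EdgeOrientation G) (x : V → ℝ) (e : G.edgeSet) :
    ((incidence o).transpose.mulVec x) e = x (o.head e) - x (o.tail e) := by
  simp [Matrix.mulVec, dotProduct, incidence, sub_mul, Finset.sum_sub_distrib]

lemma incidence_transpose_mulVec_eq_zero_iff (o : EdgeOrientation G) (x : V → ℝ) :
    (incidence o).transpose.mulVec x = 0 ↔ ∀ i j, G.Adj i j → x i = x j := by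
  constructor
  · intro h i j hij
    have he := congrFun h ⟨s(i, j), hij⟩
    rw [incidence_transpose_mulVec, Pi.zero_apply, sub_eq_zero] at he
    have hm := o.mk_eq ⟨s(i, j), hij⟩
    rcases Sym2.eq_iff.1 hm with ⟨h1, h2⟩ | ⟨h1, h2⟩
    · rw [h1, h2] at he; exact he.symm
    · rw [h1, h2] at he; exact he
  · intro h
    ext e
    rw [incidence_transpose_mulVec, Pi.zero_apply, sub_eq_zero]
    have hadj : G.Adj (o.tail e) (o.head e) := by
      rw [← SimpleGraph.mem_edgeSet, o.mk_eq e]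
      exact e.2
    exact (h _ _ hadj).symm

variable [DecidableRel G.Adj]

lemma rank_incidence_add_card_connectedComponent (o : EdgeOrientation G) :
    (incidence o).rank + Nat.card G.ConnectedComponent = Fintype.card V := by
  classical
  have hker : LinearMap.ker (incidence o).transpose.mulVecLin =
      LinearMap.ker (Matrix.toLin' (G.lapMatrix ℝ)) := by
    ext x
    rw [LinearMap.mem_ker, LinearMap.mem_ker, Matrix.mulVecLin_apply, Matrix.toLin'_apply,
      incidence_transpose_mulVec_eq_zero_iff, SimpleGraph.lapMatrix_mulVec_eq_zero_iff_forall_adj]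
  have h := LinearMap.finrank_range_add_finrank_ker (incidence o).transpose.mulVecLin
  rw [hker, ← SimpleGraph.card_connectedComponent_eq_finrank_ker_toLin'_lapMatrix,
    Module.finrank_fintype_fun_eq_card] at h
  rw [← Matrix.rank_transpose, Nat.card_eq_fintype_card]
  exact h

lemma rank_incidence_add_finrank_homologyOne (o : EdgeOrientation G) :
    (incidence o).rank + Module.finrank ℝ (homologyOne o) = G.edgeFinset.card := by
  have h := LinearMap.finrank_range_add_finrank_ker (Matrix.toEuclideanLin (incidence o))
  have hr : (incidence o).rank =
      Module.finrank ℝ (LinearMap.range (Matrix.toEuclideanLin (incidence o))) := by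
    rw [Matrix.toEuclideanLin_eq_toLin_orthonormal]
    exact Matrix.rank_eq_finrank_range_toLin _ _ _
  rw [finrank_euclideanSpace, ← hr] at h
  rw [SimpleGraph.edgeFinset_card]
  exact h

lemma finrank_homologyOne_orthogonal (o : EdgeOrientation G) :
    Module.finrank ℝ (homologyOne o)ᗮ = (incidence o).rank := by
  have h1 := rank_incidence_add_finrank_homologyOne o
  have h2 := (homologyOne o).finrank_add_finrank_orthogonal
  rw [finrank_euclideanSpace, ← SimpleGraph.edgeFinset_card] at h2
  omega

end Homology

/-! ### Smooth maps into the equilibrium set -/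

/-- The derivative of a map with values in a linear subspace takes values in that subspace. -/
lemma fderiv_apply_mem_of_eventually_mem {E F : Type*} [NormedAddCommGroup E] [NormedSpace ℝ E]
    [NormedAddCommGroup F] [InnerProductSpace ℝ F] (S : Submodule ℝ F)
    [S.HasOrthogonalProjection] {g : E → F} {g' : E →L[ℝ] F} {w : E} (hg : HasFDerivAt g g' w)
    (h : ∀ᶠ x in nhds w, g x ∈ S) (v : E) : g' v ∈ S := by
  have h1 : HasFDerivAt (fun x => Sᗮ.starProjection (g x)) (Sᗮ.starProjection.comp g') w :=
    Sᗮ.starProjection.hasFDerivAt.comp w hg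
  have h2 : (fun x => Sᗮ.starProjection (g x)) =ᶠ[nhds w] fun _ => 0 := by
    filter_upwards [h] with x hx
    rw [Submodule.starProjection_apply_eq_zero_iff, Submodule.orthogonal_orthogonal]
    exact hx
  have h3 := h1.unique ((hasFDerivAt_const (0 : F) w).congr_of_eventuallyEq h2)
  have h4 : Sᗮ.starProjection (g' v) = 0 := by
    simpa using DFunLike.congr_fun h3 v
  rwa [Submodule.starProjection_apply_eq_zero_iff, Submodule.orthogonal_orthogonal] at h4

/-- The zeros of the derivative of a coupling function are isolated. -/
lemma IsCoupling.eventually_deriv_ne_zero {f : ℝ → ℝ} (hf : IsCoupling f) (a : ℝ) :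
    ∀ᶠ x in nhdsWithin a {a}ᶜ, deriv f x ≠ 0 := by
  have hd : AnalyticOnNhd ℝ (deriv f) Set.univ := hf.analytic.deriv
  refine (hd a trivial).eventually_eq_zero_or_eventually_ne_zero.resolve_left fun h0 => ?_
  have hz := hd.eqOn_zero_of_preconnected_of_eventuallyEq_zero isPreconnected_univ
    (Set.mem_univ a) h0
  exact hf.not_const ⟨f 0, fun x => is_const_of_deriv_eq_zero
    (fun y => (hf.analytic y trivial).differentiableAt) (fun y => hz (Set.mem_univ y)) x 0⟩

/-- If `f' ∘ g` vanishes near `w`, then `g` is constant near `w`. -/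
lemma IsCoupling.fderiv_eq_zero {f : ℝ → ℝ} (hf : IsCoupling f) {E : Type*}
    [NormedAddCommGroup E] [NormedSpace ℝ E] {g : E → ℝ} {w : E} (hg : ContinuousAt g w)
    (h : ∀ᶠ x in nhds w, deriv f (g x) = 0) : fderiv ℝ g w = 0 := by
  have h1 : ∀ᶠ x in nhds w, g x ∈ ({g w} : Set ℝ)ᶜ → deriv f (g x) ≠ 0 :=
    hg.eventually (eventually_nhdsWithin_iff.1 (hf.eventually_deriv_ne_zero (g w)))
  have h2 : g =ᶠ[nhds w] fun _ => g w := by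
    filter_upwards [h, h1] with x hx hx1
    by_contra hne
    exact hx1 hne hx
  rw [h2.fderiv_eq, fderiv_fun_const, Pi.zero_apply]

/-- For finitely many continuous functions on a nonempty open set, there is a point `w` where, for
each of them, `f'` does not vanish at the value or the derivative does. -/
lemma IsCoupling.exists_deriv_ne_zero_or_fderiv_eq_zero {f : ℝ → ℝ} (hf : IsCoupling f)
    {E ι : Type*} [NormedAddCommGroup E] [NormedSpace ℝ E] [Finite ι] {W : Set E}
    (hW : IsOpen W) (hne : W.Nonempty) {g : ι → E → ℝ} (hg : ∀ i, ContinuousOn (g i) W) :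
    ∃ w ∈ W, ∀ i, deriv f (g i w) ≠ 0 ∨ fderiv ℝ (g i) w = 0 := by
  classical
  have := Fintype.ofFinite ι
  have hdc : Continuous (deriv f) := continuousOn_univ.1 hf.analytic.deriv.continuousOn
  suffices H : ∀ s : Finset ι, ∃ U ⊆ W, IsOpen U ∧ U.Nonempty ∧
      ∀ w ∈ U, ∀ i ∈ s, deriv f (g i w) ≠ 0 ∨ fderiv ℝ (g i) w = 0 by
    obtain ⟨U, hUW, -, ⟨w, hw⟩, h⟩ := H Finset.univ
    exact ⟨w, hUW hw, fun i => h w hw i (Finset.mem_univ i)⟩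
  intro s
  induction s using Finset.induction_on with
  | empty => exact ⟨W, subset_rfl, hW, hne, by simp⟩
  | insert i s _ ih =>
    obtain ⟨U, hUW, hU, hUne, h⟩ := ih
    have hgU : ContinuousOn (fun w => deriv f (g i w)) U :=
      hdc.comp_continuousOn ((hg i).mono hUW)
    by_cases hz : ∀ w ∈ U, deriv f (g i w) = 0
    · refine ⟨U, hUW, hU, hUne, fun w hw j hj => ?_⟩
      rcases Finset.mem_insert.1 hj with rfl | hj
      · exact Or.inr (hf.fderiv_eq_zero ((hg j).continuousAt (hW.mem_nhds (hUW hw)))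
          ((hU.eventually_mem hw).mono hz))
      · exact h w hw j hj
    · push Not at hz
      obtain ⟨w₀, hw₀, hne₀⟩ := hz
      refine ⟨U ∩ (fun w => deriv f (g i w)) ⁻¹' {0}ᶜ, Set.inter_subset_left.trans hUW,
        hgU.isOpen_inter_preimage hU isOpen_compl_singleton, ⟨w₀, hw₀, hne₀⟩,
        fun w hw j hj => ?_⟩
      rcases Finset.mem_insert.1 hj with rfl | hj
      · exact Or.inl hw.2
      · exact h w hw.1 j hj

section Equilibria

variable {V : Type*} [Fintype V] [DecidableEq V] {G : SimpleGraph V} [DecidableRel G.Adj]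

lemma finrank_le_of_immersion_into_equilibria {o : EdgeOrientation G} {f : ℝ → ℝ}
    (hf : IsCoupling f) {E : Type*} [NormedAddCommGroup E] [NormedSpace ℝ E]
    {W : Set E} (hW : IsOpen W) (hne : W.Nonempty) {φ : E → EuclideanSpace ℝ G.edgeSet}
    (hφ : DifferentiableOn ℝ φ W) (hinj : ∀ w ∈ W, Function.Injective (fderiv ℝ φ w))
    (hmem : ∀ w ∈ W, φ w ∈ equilibria o f) :
    Module.finrank ℝ E ≤ Module.finrank ℝ (homologyOne o)ᗮ ∧
      Module.finrank ℝ E ≤ Module.finrank ℝ (homologyOne o) := by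
  obtain ⟨w, hw, hgood⟩ := hf.exists_deriv_ne_zero_or_fderiv_eq_zero hW hne
    (g := fun (e : G.edgeSet) x => φ x e)
    (fun e => (EuclideanSpace.proj e).continuous.comp_continuousOn hφ.continuousOn)
  have hD : HasFDerivAt φ (fderiv ℝ φ w) w :=
    (hφ.differentiableAt (hW.mem_nhds hw)).hasFDerivAt
  have hcoord : ∀ e : G.edgeSet, HasFDerivAt (fun x => φ x e)
      ((EuclideanSpace.proj e).comp (fderiv ℝ φ w)) w :=
    fun e => hasFDerivWithinAt_univ.1 (hasFDerivWithinAt_euclidean.1 hD.hasFDerivWithinAt e)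
  have hev : ∀ᶠ x in nhds w, x ∈ W := hW.eventually_mem hw
  refine ⟨LinearMap.finrank_le_finrank_of_injective
    (f := (fderiv ℝ φ w).toLinearMap.codRestrict (homologyOne o)ᗮ fun v =>
      fderiv_apply_mem_of_eventually_mem _ hD (hev.mono fun x hx => (hmem x hx).2) v)
    fun v v' h => hinj w hw (congrArg Subtype.val h), ?_⟩
  -- The derivative of `𝐟 ∘ φ`, which is the derivative of `φ` with coordinates scaled by `f'`.
  let L : E →L[ℝ] EuclideanSpace ℝ G.edgeSet :=
    (EuclideanSpace.equiv G.edgeSet ℝ).symm.toContinuousLinearMap.comp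
      (ContinuousLinearMap.pi fun e =>
        deriv f (φ w e) • (EuclideanSpace.proj e).comp (fderiv ℝ φ w))
  have hLe : ∀ v e, L v e = deriv f (φ w e) * fderiv ℝ φ w v e := fun v e => rfl
  have hL : HasFDerivAt (fun x => edgeMap G f (φ x)) L w :=
    hasFDerivWithinAt_univ.1 <| hasFDerivWithinAt_euclidean.2 fun e =>
      ((hf.analytic (φ w e) trivial).differentiableAt.hasDerivAt.comp_hasFDerivAt w
        (hcoord e)).hasFDerivWithinAt
  refine LinearMap.finrank_le_finrank_of_injective
    (f := L.toLinearMap.codRestrict (homologyOne o) fun v =>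
      fderiv_apply_mem_of_eventually_mem _ hL (hev.mono fun x hx => (hmem x hx).1) v)
    fun v v' h => hinj w hw ?_
  have h' : L v = L v' := congrArg Subtype.val h
  ext e
  rcases hgood e with hfe | hze
  · have he : L v e = L v' e := by rw [h']
    rw [hLe, hLe] at he
    exact mul_left_cancel₀ hfe he
  · rw [(hcoord e).fderiv] at hze
    exact (DFunLike.congr_fun hze v).trans (DFunLike.congr_fun hze v').symm

lemma zero_mem_equilibria (o : EdgeOrientation G) {f : ℝ → ℝ} (hf : IsCoupling f) :
    0 ∈ equilibria o f := by
  have h0 : f 0 = 0 := by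
    have := hf.odd 0
    rw [neg_zero] at this
    linarith
  have h1 : edgeMap G f 0 = 0 := by
    ext e
    exact h0
  exact ⟨by rw [Set.mem_preimage, h1]; exact zero_mem _, zero_mem _⟩

end Equilibria

/-! ### Dimension of sets -/

lemma isSmoothSubmanifold_zero_singleton {F : Type*} [NormedAddCommGroup F] [NormedSpace ℝ F]
    (p : F) : IsSmoothSubmanifold 0 ({p} : Set F) := by
  rintro q rfl
  refine ⟨Set.univ, Set.univ, fun _ => q, isOpen_univ, trivial, isOpen_univ, contDiffOn_const,
    fun w _ => Function.injective_of_subsingleton _, Topology.IsEmbedding.of_subsingleton _, ?_⟩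
  simp

lemma exists_manifoldDim_eq_coe {F : Type*} [NormedAddCommGroup F] [NormedSpace ℝ F]
    {X : Set F} (hX : X.Nonempty) {N : ℕ}
    (hN : ∀ d M, M.Nonempty → M ⊆ X → IsSmoothSubmanifold d M → d ≤ N) :
    ∃ d : ℕ, manifoldDim X = (d : WithBot ℕ∞) ∧ d ≤ N := by
  obtain ⟨p, hp⟩ := hX
  have hle : manifoldDim X ≤ ((N : ℕ∞) : WithBot ℕ∞) :=
    iSup₂_le fun d ⟨M, h1, h2, h3⟩ => by exact_mod_cast hN d M h1 h2 h3
  have hge : ((0 : ℕ∞) : WithBot ℕ∞) ≤ manifoldDim X :=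
    le_iSup₂_of_le 0 ⟨{p}, Set.singleton_nonempty p, Set.singleton_subset_iff.2 hp,
      isSmoothSubmanifold_zero_singleton p⟩ le_rfl
  obtain ⟨x, hx, -⟩ := WithBot.coe_le_iff.1 hge
  rw [hx, WithBot.coe_le_coe] at hle
  obtain ⟨d, rfl⟩ := ENat.ne_top_iff_exists.1 (ne_top_of_le_ne_top (ENat.natCast_ne_top N) hle)
  exact ⟨d, hx, by exact_mod_cast hle⟩

end GraphDyn

theorem mainTheorem8 {V : Type*} [Fintype V] [DecidableEq V] (G : SimpleGraph V)
    [DecidableRel G.Adj] (o : GraphDyn.EdgeOrientation G) (f : ℝ → ℝ)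
    (hf : GraphDyn.IsCoupling f) (n m c : ℕ) (hn : n = Fintype.card V)
    (hm : m = G.edgeFinset.card) (hc : c = Nat.card G.ConnectedComponent) :
    ∃ d : ℕ, GraphDyn.manifoldDim (GraphDyn.equilibria o f) = (d : WithBot ℕ∞) ∧
      (d : ℤ) ≤ (n : ℤ) - (c : ℤ) ∧
      (d : ℤ) ≤ ⌊(m : ℝ) / 2⌋ ∧
      (d : ℤ) ≤ (m : ℤ) - (n : ℤ) + (c : ℤ) := by
  have h1 := GraphDyn.rank_incidence_add_card_connectedComponent o
  have h2 := GraphDyn.rank_incidence_add_finrank_homologyOne o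
  have h3 := GraphDyn.finrank_homologyOne_orthogonal o
  obtain ⟨d, hd, hdle⟩ := GraphDyn.exists_manifoldDim_eq_coe
    (X := GraphDyn.equilibria o f) ⟨0, GraphDyn.zero_mem_equilibria o hf⟩
    (N := min (Module.finrank ℝ (GraphDyn.homologyOne o)ᗮ)
      (Module.finrank ℝ (GraphDyn.homologyOne o))) (by
      rintro d M ⟨p, hp⟩ hMX hM
      obtain ⟨U, W, φ, -, hpU, hW, hφ, hinj, -, himg⟩ := hM p hp
      have hne : W.Nonempty := by
        rw [← Set.image_nonempty (f := φ), himg]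
        exact ⟨p, hp, hpU⟩
      have hmem : ∀ w ∈ W, φ w ∈ GraphDyn.equilibria o f := fun w hw =>
        hMX (himg.subset (Set.mem_image_of_mem φ hw)).1
      have h := GraphDyn.finrank_le_of_immersion_into_equilibria hf hW hne
        (hφ.differentiableOn (by simp)) hinj hmem
      rw [finrank_euclideanSpace_fin] at h
      exact le_min h.1 h.2)
  obtain ⟨ha, hb⟩ := le_min_iff.1 hdle
  refine ⟨d, hd, by omega, ?_, by omega⟩
  rw [Int.le_floor, le_div_iff₀ two_pos]
  have : d * 2 ≤ m := by omega
  exact_mod_cast this
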